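/- Let $A$ be a principal ideal domain. Call a prime ideal $\mathfrak p$ of $A$ real if $-1$ is not a sum of squares in $A/\mathfrak p$, and call an irreducible $q\in A$ non-real if the prime ideal $(q)$ is not real. Let ${\rm Spec_r}A$ be the real spectrum of $A$, i.e. the set of all pairs $\alpha=(\mathfrak p,\le_\alpha)$ where $\mathfrak p$ is a real prime ideal of $A$ and $\le_\alpha$ is a (total, ring) ordering of $A/\mathfrak p$; for $a\in A$ write $a>_\alpha 0$ (resp. $a\ge_\alpha 0$) if the class of $a$ in $A/\mathfrak p$ is $>0$ (resp. $\ge 0$) for $\le_\alpha$. Assume that $A$ satisfies (PNRI) every non-real irreducible $q\in A$ is associated to a non-real irreducible $q'$ such that $q'>_\alpha 0$ for all $\alpha\in{\rm Spec_r}A$. Let $M\in A^{n\times n}$ be a symmetric matrix which is positive semi-definite on ${\rm Spec_r}A$, i.e. such that for every ring morphism $\phi:A\to R$ into a real closed field $R$ the matrix $\phi(M)$ is positive semi-definite. Let ${\rm diag}(d_1,\dots,d_r,0,\dots,0)$, with $d_1,\dots,d_r\in A$ nonzero and $d_1\mid d_2\mid\dots\mid d_r$, be the Smith normal form of $M$,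 i.e. $M=P\,{\rm diag}(d_1,\dots,d_r,0,\dots,0)\,Q$ with $P,Q\in A^{n\times n}$ invertible over $A$. Then, for every $k=1,\dots,r$, the element $d_k$ is associated to an element $d'_k\in A$ such that $d'_k\ge_\alpha 0$ for all $\alpha\in{\rm Spec_r}A$. -/

import Mathlib

universe u

/-- A prime ideal `p` of `A` is real if `A ⧸ p` is formally real, i.e. `-1` is not a sum of
squares in `A ⧸ p` (this is what Mathlib calls `IsSemireal`). -/
def IsRealPrime {A : Type u} [CommRing A] (p : Ideal A) : Prop :=
  p.IsPrime ∧ IsSemireal (A ⧸ p)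

/-- A point of the real spectrum of `A`: a real prime ideal `supp` of `A` together with a (total,
ring) ordering on `A ⧸ supp`. -/
structure RealSpec (A : Type u) [CommRing A] where
  /-- The support of the point. -/
  supp : Ideal A
  isRealPrime : IsRealPrime supp
  /-- The ordering on the quotient by the support. -/
  order : LinearOrder (A ⧸ supp)
  isStrictOrderedRing : @IsStrictOrderedRing (A ⧸ supp) _ order.toPartialOrder

/-- `a ≥ 0` at the point `α` of the real spectrum. -/
def RealSpec.Nonneg {A : Type u} [CommRing A] (α : RealSpec A) (a : A) : Prop :=
  α.order.le 0 (Ideal.Quotient.mk α.supp a)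

/-- `a > 0` at the point `α` of the real spectrum. -/
def RealSpec.Pos {A : Type u} [CommRing A] (α : RealSpec A) (a : A) : Prop :=
  α.order.lt 0 (Ideal.Quotient.mk α.supp a)

/-- A non-real irreducible: an irreducible element which does not generate a real prime ideal. -/
def IsNonRealIrreducible {A : Type u} [CommRing A] (q : A) : Prop :=
  Irreducible q ∧ ¬ IsRealPrime (Ideal.span {q})

/-- Condition (PNRI), positivity of non-real irreducibles: every non-real irreducible is associated
to a non-real irreducible which is strictly positive at every point of the real spectrum. -/
def PNRI (A : Type u) [CommRing A] : Prop :=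
  ∀ q : A, IsNonRealIrreducible q →
    ∃ q' : A, Associated q q' ∧ IsNonRealIrreducible q' ∧ ∀ α : RealSpec A, α.Pos q'

/-- A square matrix `M` over `A` (meant to be symmetric) is positive semidefinite on the real
spectrum of `A`: for every ring morphism `φ` from `A` to a real closed field `R`, with its (unique)
ordering, the quadratic form of `φ(M)` takes nonnegative values on `Rⁿ`. -/
def PsdOnRealSpec {A : Type u} [CommRing A] {n : ℕ} (M : Matrix (Fin n) (Fin n) A) : Prop :=
  ∀ (R : Type u) [Field R] [LinearOrder R] [IsStrictOrderedRing R] [IsRealClosed R]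
    (φ : A →+* R) (x : Fin n → R), 0 ≤ x ⬝ᵥ ((M.map φ).mulVec x)

/-- Equivalence of square matrices: `M = P N Q` with `P`, `Q` invertible over `A`. -/
def MatrixEquivalent {A : Type u} [CommRing A] {n : ℕ} (M N : Matrix (Fin n) (Fin n) A) : Prop :=
  ∃ P Q : Matrix (Fin n) (Fin n) A, IsUnit P.det ∧ IsUnit Q.det ∧ M = P * N * Q

/-- The `n × n` matrix `diag(d₁, …, d_r, 0, …, 0)`. -/
def diagPad {A : Type u} [CommRing A] (n : ℕ) {r : ℕ} (d : Fin r → A) :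
    Matrix (Fin n) (Fin n) A :=
  Matrix.diagonal fun i : Fin n => if h : (i : ℕ) < r then d ⟨i, h⟩ else 0

/-- `diag(d₁, …, d_r, 0, …, 0)` is the Smith normal form of `M`: the `d_k` are nonzero, they divide
each other successively, and the diagonal matrix is equivalent to `M`. -/
structure IsSmithNormalForm {A : Type u} [CommRing A] {n r : ℕ} (M : Matrix (Fin n) (Fin n) A)
    (d : Fin r → A) : Prop where
  le : r ≤ n
  ne_zero : ∀ k, d k ≠ 0
  dvd : ∀ j k, j ≤ k → d j ∣ d k
  equiv : MatrixEquivalent M (diagPad n d)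

/-!
By the theorem of Artin, an element which is nonnegative on the real spectrum becomes a sum of
squares of `A` after multiplication by a nonzero square. If `q` generates a real prime, then `q`
divides every term of a sum of squares which it divides, so sums of squares, and with them the
elements nonnegative on the real spectrum, have even order at `q`.

Let `B` be the bilinear form of `M`. The transformations which diagonalize `M` yield vectors `v`
and `w` such that `B v w = d` is the chosen diagonal entry and `d` divides `B v v` and `B w w`.
Since `B (v + w) (v + w) = B v v + B w w + 2 * d` and these three values of the quadratic form have
even order at `q`, while `q` does not divide `2`, the order of `d` at `q` is even. So `d` is a
square up to units and non-real primes, and (PNRI) makes the latter positive.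
-/

open Polynomial

section SumsOfSquares

theorem isSumSq_map {R S : Type*} [NonAssocSemiring R] [NonAssocSemiring S] (φ : R →+* S) {s : R}
    (hs : IsSumSq s) : IsSumSq (φ s) := by
  induction hs with
  | zero => rw [map_zero]; exact .zero
  | sq_add a _ ih => rw [map_add, map_mul]; exact .sq_add (φ a) ih

theorem exists_isSumSq_map_eq {R S : Type*} [NonAssocSemiring R] [NonAssocSemiring S]
    {φ : R →+* S} (hφ : Function.Surjective φ) {s : S} (hs : IsSumSq s) :
    ∃ t, IsSumSq t ∧ φ t = s := by
  induction hs with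
  | zero => exact ⟨0, .zero, map_zero φ⟩
  | sq_add a _ ih =>
    obtain ⟨t, ht, rfl⟩ := ih
    obtain ⟨b, rfl⟩ := hφ a
    exact ⟨b * b + t, .sq_add b ht, by rw [map_add, map_mul]⟩

theorem isSumSq_div {F : Type*} [Semifield F] {s t : F} (hs : IsSumSq s) (ht : IsSumSq t) :
    IsSumSq (s / t) := by
  have hst : s / t = s * t * (t⁻¹ * t⁻¹) := by
    rcases eq_or_ne t 0 with rfl | ht0
    · simp
    · field_simp
  exact hst ▸ (hs.mul ht).mul (.mul_self _)

theorem isSumSq_of_isSumSq_neg_one {F : Type*} [Field F] (h2 : (2 : F) ≠ 0)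
    (h : IsSumSq (-1 : F)) (a : F) : IsSumSq a := by
  have ha : a = (a + 1) / 2 * ((a + 1) / 2) + -1 * ((a - 1) / 2 * ((a - 1) / 2)) := by
    field_simp
    ring
  rw [ha]
  exact .sq_add _ (h.mul (.mul_self _))

theorem isSemireal_of_ringHom {R S : Type*} [NonAssocSemiring R] [NonAssocSemiring S]
    [IsSemireal S] (φ : R →+* S) : IsSemireal R where
  one_add_ne_zero {s} hs h := by
    refine IsSemireal.one_add_ne_zero (isSumSq_map φ hs) ?_
    rw [← map_one φ, ← map_add, h, map_zero]

theorem isFormallyReal_of_isSemireal (F : Type*) [Field F] [IsSemireal F] : IsFormallyReal F := by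
  refine .of_eq_zero_of_eq_zero_of_mul_self_add fun {s a} hs h => ?_
  by_contra ha
  refine IsSemireal.one_add_ne_zero (isSumSq_div hs (.mul_self a)) ?_
  field_simp
  linear_combination h

end SumsOfSquares

section Polynomial

theorem dvd_sub_mod {R : Type*} [EuclideanDomain R] (a b : R) : b ∣ a - a % b :=
  ⟨a / b, by rw [EuclideanDomain.mod_eq_sub_mul_div, sub_sub_cancel]⟩

theorem even_natDegree_and_isSumSq_leadingCoeff {R : Type*} [CommRing R] [NoZeroDivisors R]
    [IsFormallyReal R] {p : R[X]} (hp : IsSumSq p) :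
    Even p.natDegree ∧ IsSumSq p.leadingCoeff := by
  induction hp with
  | zero => simp
  | @sq_add g s _ ih =>
    have hg : Even (g * g).natDegree ∧ IsSumSq (g * g).leadingCoeff := by
      rw [leadingCoeff_mul, ← pow_two, natDegree_pow]
      exact ⟨even_two_mul _, .mul_self _⟩
    rcases lt_trichotomy (g * g).degree s.degree with hlt | heq | hgt
    · rwa [natDegree_add_eq_right_of_degree_lt hlt, leadingCoeff_add_of_degree_lt hlt]
    · by_cases hlc : (g * g).leadingCoeff + s.leadingCoeff = 0
      · have hg0 := IsFormallyReal.eq_zero_of_add_right hg.2 ih.2 hlc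
        rwa [leadingCoeff_eq_zero.mp hg0, zero_add]
      · have hdeg := (degree_add_eq_of_leadingCoeff_add_ne_zero hlc).trans (by rw [heq, max_self])
        rw [natDegree_eq_of_degree_eq hdeg, leadingCoeff_add_of_degree_eq heq hlc]
        exact ⟨ih.1, hg.2.add ih.2⟩
    · rwa [natDegree_add_eq_left_of_degree_lt hgt, leadingCoeff_add_of_degree_lt' hgt]

variable {F : Type*} [Field F]

theorem exists_isSumSq_dvd_sub_natDegree_le {f s : F[X]} (hf : f.natDegree ≠ 0) (hs : IsSumSq s) :
    ∃ t, IsSumSq t ∧ f ∣ s - t ∧ t.natDegree ≤ 2 * (f.natDegree - 1) := by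
  induction hs with
  | zero => exact ⟨0, .zero, by simp, by simp⟩
  | sq_add g _ ih =>
    obtain ⟨t, ht, hdvd, hdeg⟩ := ih
    have hmod : f ∣ g - g % f := dvd_sub_mod g f
    have hlt : (g % f).natDegree < f.natDegree := natDegree_mod_lt g hf
    refine ⟨g % f * (g % f) + t, .sq_add _ ht, ?_, natDegree_add_le_of_degree_le ?_ hdeg⟩
    · convert (hmod.mul_right (g + g % f)).add hdvd using 1
      ring
    · rw [← pow_two, natDegree_pow]
      lia

/- Squares may be reduced modulo `f`, so `1 + s` becomes a polynomial of even degree less than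
`2 * f.natDegree`; its cofactor by `f` then has odd degree less than `f.natDegree`. -/
theorem not_dvd_one_add_of_odd_natDegree [IsSemireal F] {f s : F[X]} (hf : Odd f.natDegree)
    (hs : IsSumSq s) : ¬ f ∣ 1 + s := by
  induction hn : f.natDegree using Nat.strong_induction_on generalizing f s with
  | h n ih =>
  subst hn
  intro hfs
  have := isFormallyReal_of_isSemireal F
  have : IsSemireal F[X] := isSemireal_of_ringHom (evalRingHom 0)
  obtain ⟨t, ht, hst, hdeg⟩ := exists_isSumSq_dvd_sub_natDegree_le hf.pos.ne' hs
  have hft : f ∣ 1 + t := by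
    convert hfs.sub hst using 1
    ring
  have ht0 : 1 + t ≠ 0 := IsSemireal.one_add_ne_zero ht
  obtain ⟨heven, -⟩ := even_natDegree_and_isSumSq_leadingCoeff (IsSumSq.one.add ht)
  have hle : (1 + t).natDegree ≤ 2 * (f.natDegree - 1) :=
    natDegree_add_le_of_degree_le (by simp) hdeg
  obtain ⟨h, hfh⟩ := hft
  rw [hfh] at ht0
  rw [hfh, natDegree_mul (left_ne_zero_of_mul ht0) (right_ne_zero_of_mul ht0)] at heven hle
  have hodd : Odd h.natDegree := (Nat.even_add'.mp heven).mp hf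
  have := hf.pos
  exact ih h.natDegree (by lia) hodd ht rfl ⟨f, by rw [hfh, mul_comm]⟩

theorem exists_irreducible_dvd_odd_natDegree {f : F[X]} (hf : Odd f.natDegree) :
    ∃ p, Irreducible p ∧ p ∣ f ∧ Odd p.natDegree := by
  induction f using WfDvdMonoid.induction_on_irreducible with
  | zero => simp at hf
  | unit u hu => simp [natDegree_eq_zero_of_isUnit hu] at hf
  | mul g p hg hp ih =>
    rw [natDegree_mul hp.ne_zero hg, Nat.odd_add] at hf
    by_cases hpodd : Odd p.natDegree
    · exact ⟨p, hp, dvd_mul_right p g, hpodd⟩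
    · obtain ⟨q, hq, hqg, hqodd⟩ := ih (by simpa using mt hf.mpr hpodd)
      exact ⟨q, hq, hqg.mul_left p, hqodd⟩

theorem isSemireal_adjoinRoot {f : F[X]} (hf : ∀ s, IsSumSq s → ¬ f ∣ 1 + s) :
    IsSemireal (AdjoinRoot f) where
  one_add_ne_zero {s} hs h := by
    obtain ⟨t, ht, rfl⟩ := exists_isSumSq_map_eq AdjoinRoot.mk_surjective hs
    rw [← map_one (AdjoinRoot.mk f), ← map_add, AdjoinRoot.mk_eq_zero] at h
    exact hf t ht h

theorem irreducible_X_sq_sub_C {a : F} (ha : ¬ IsSquare a) : Irreducible (X ^ 2 - C a) :=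
  X_pow_sub_C_irreducible_of_prime Nat.prime_two fun b hb => ha ⟨b, by rw [← hb, pow_two]⟩

theorem exists_dvd_sub_linear_of_isSumSq (a : F) {s : F[X]} (hs : IsSumSq s) :
    ∃ u v w : F, IsSumSq u ∧ IsSumSq v ∧ X ^ 2 - C a ∣ s - (C w * X + C (u + a * v)) := by
  induction hs with
  | zero => exact ⟨0, 0, 0, .zero, .zero, by simp⟩
  | sq_add g _ ih =>
    obtain ⟨u, v, w, hu, hv, hdvd⟩ := ih
    have hmod : X ^ 2 - C a ∣ g - g % (X ^ 2 - C a) := dvd_sub_mod g _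
    have hlt : (g % (X ^ 2 - C a)).natDegree < 2 :=
      (natDegree_mod_lt g (by simp)).trans_eq natDegree_X_pow_sub_C
    obtain ⟨y, x, hyx⟩ := exists_eq_X_add_C_of_natDegree_le_one (Nat.le_of_lt_succ hlt)
    rw [hyx] at hmod
    refine ⟨x * x + u, y * y + v, 2 * x * y + w, .sq_add x hu, .sq_add y hv, ?_⟩
    convert ((hmod.mul_right (g + (C y * X + C x))).add hdvd).add
      (dvd_mul_right (X ^ 2 - C a) (C y * C y)) using 1
    simp only [map_add, map_mul, map_ofNat]
    ring

theorem isSemireal_adjoinRoot_X_sq_sub_C [IsSemireal F] {a : F} (ha : ¬ IsSumSq (-a)) :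
    IsSemireal (AdjoinRoot (X ^ 2 - C a)) := by
  refine isSemireal_adjoinRoot fun s hs hdvd => ha ?_
  obtain ⟨u, v, w, hu, hv, hsub⟩ := exists_dvd_sub_linear_of_isSumSq a hs
  have hlin : C w * X + C (1 + u + a * v) = 0 := by
    refine eq_zero_of_dvd_of_natDegree_lt (p := X ^ 2 - C a) ?_ ?_
    · convert hdvd.sub hsub using 1
      simp only [map_add, map_one]
      ring
    · rw [natDegree_X_pow_sub_C]
      exact natDegree_linear_le.trans_lt one_lt_two
  have hrel : 1 + u + a * v = 0 := by simpa using congrArg (coeff · 0) hlin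
  have hv0 : v ≠ 0 := by
    rintro rfl
    exact IsSemireal.one_add_ne_zero hu (by simpa using hrel)
  have hneg : -a = (1 + u) / v := by
    field_simp
    linear_combination -hrel
  exact hneg ▸ isSumSq_div (IsSumSq.one.add hu) hv

end Polynomial

section RealClosure

theorem isRealClosed_of_forall_exists_isRoot {F : Type*} [Field F] [IsSemireal F]
    (hF : ∀ p : F[X], Irreducible p → IsSemireal (AdjoinRoot p) → ∃ x, p.IsRoot x) :
    IsRealClosed F := by
  have := isFormallyReal_of_isSemireal F
  have hsq (a : F) : IsSquare a ∨ IsSumSq (-a) := by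
    rw [or_iff_not_imp_left]
    intro ha
    by_contra hneg
    obtain ⟨x, hx⟩ := hF _ (irreducible_X_sq_sub_C ha) (isSemireal_adjoinRoot_X_sq_sub_C hneg)
    exact ha ⟨x, by simpa [sub_eq_zero, pow_two, eq_comm] using hx⟩
  have hsum {s : F} (hs : IsSumSq s) : IsSquare s := (hsq s).elim id fun hneg => by
    rw [IsFormallyReal.eq_zero_of_isSumSq_of_neg_isSumSq hs hneg]
    exact .zero
  refine ⟨fun a => (hsq a).imp_right hsum, fun hf => ?_⟩
  obtain ⟨p, hp, ⟨g, rfl⟩, hpodd⟩ := exists_irreducible_dvd_odd_natDegree hf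
  obtain ⟨x, hx⟩ := hF p hp
    (isSemireal_adjoinRoot fun _ hs => not_dvd_one_add_of_odd_natDegree hpodd hs)
  exact ⟨x, root_mul_right_of_isRoot g hx⟩

theorem isSemireal_sSup_of_directedOn {C : Type*} [Field C] {c : Set (Subfield C)}
    (hne : c.Nonempty) (hc : DirectedOn (· ≤ ·) c) (hreal : ∀ E ∈ c, IsSemireal E) :
    IsSemireal (sSup c : Subfield C) := by
  have hdescend (s : (sSup c : Subfield C)) (hs : IsSumSq s) :
      ∃ E ∈ c, ∃ t : E, IsSumSq t ∧ (t : C) = s := by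
    induction hs with
    | zero => exact ⟨hne.some, hne.some_mem, 0, .zero, rfl⟩
    | sq_add b _ ih =>
      obtain ⟨E, hE, t, ht, hts⟩ := ih
      obtain ⟨E', hE', hb⟩ := (Subfield.mem_sSup_of_directedOn hne hc).mp b.2
      obtain ⟨D, hD, hED, hED'⟩ := hc E hE E' hE'
      refine ⟨D, hD, ⟨b, hED' hb⟩ * ⟨b, hED' hb⟩ + Subfield.inclusion hED t,
        .sq_add _ (isSumSq_map _ ht), ?_⟩
      exact congrArg ((b : C) * b + ·) hts
  refine ⟨fun {s} hs h => ?_⟩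
  obtain ⟨E, hE, t, ht, hts⟩ := hdescend s hs
  have := hreal E hE
  refine IsSemireal.one_add_ne_zero ht (Subtype.ext ?_)
  simpa [hts] using congrArg Subtype.val h

theorem exists_isRealClosed_subfield_ge {C : Type*} [Field C] [IsAlgClosed C] (E : Subfield C)
    [hE : IsSemireal E] : ∃ R : Subfield C, E ≤ R ∧ IsRealClosed R := by
  obtain ⟨R, hER, hR⟩ := zorn_le_nonempty₀ {E : Subfield C | IsSemireal E}
    (fun c hcs hc E hE => ⟨sSup c, isSemireal_sSup_of_directedOn ⟨E, hE⟩ hc.directedOn hcs,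
      fun _ => le_sSup⟩) E hE
  have : IsSemireal R := hR.prop
  refine ⟨R, hER, isRealClosed_of_forall_exists_isRoot fun p hp hpreal => ?_⟩
  have := Fact.mk hp
  obtain ⟨z, hz⟩ := IsAlgClosed.exists_eval₂_eq_zero R.subtype p (degree_pos_of_irreducible hp).ne'
  let ψ : AdjoinRoot p →+* C := AdjoinRoot.lift R.subtype z hz
  have hψ : IsSemireal ψ.fieldRange :=
    isSemireal_of_ringHom ψ.rangeRestrictFieldEquiv.symm.toRingHom
  have hle : R ≤ ψ.fieldRange := fun x hx => ⟨AdjoinRoot.of p ⟨x, hx⟩, AdjoinRoot.lift_of hz⟩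
  have hzR : z ∈ R := hR.le_of_ge hψ hle ⟨AdjoinRoot.root p, AdjoinRoot.lift_root hz⟩
  refine ⟨⟨z, hzR⟩, R.subtype.injective ?_⟩
  rw [← eval₂_at_apply, map_zero]
  exact hz

theorem exists_linearOrder_isStrictOrderedRing (R : Type*) [Field R] [IsRealClosed R] :
    ∃ _ : LinearOrder R, IsStrictOrderedRing R := by
  classical
  have := isFormallyReal_of_isSemireal R
  let P : RingCone R :=
    { Subsemiring.sumSq R with
      eq_zero_of_mem_of_neg_mem' := fun hs hneg =>
        IsFormallyReal.eq_zero_of_isSumSq_of_neg_isSumSq (Subsemiring.mem_sumSq.mp hs)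
          (Subsemiring.mem_sumSq.mp hneg) }
  have : HasMemOrNegMem P := ⟨fun a => (IsRealClosed.isSquare_or_isSquare_neg a).imp
    (Subsemiring.mem_sumSq.mpr ·.isSumSq) (Subsemiring.mem_sumSq.mpr ·.isSumSq)⟩
  let _ : LinearOrder R := .mkOfAddGroupCone P
  have := IsOrderedRing.mkOfCone P
  exact ⟨inferInstance, IsOrderedRing.toIsStrictOrderedRing R⟩

theorem exists_ringHom_isRealClosed (K : Type u) [Field K] [IsSemireal K] :
    ∃ (R : Type u) (_ : Field R) (_ : LinearOrder R) (_ : IsStrictOrderedRing R)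
      (_ : IsRealClosed R), Nonempty (K →+* R) := by
  let ι := algebraMap K (AlgebraicClosure K)
  have : IsSemireal ι.fieldRange := isSemireal_of_ringHom ι.rangeRestrictFieldEquiv.symm.toRingHom
  obtain ⟨R, hR, _⟩ := exists_isRealClosed_subfield_ge ι.fieldRange
  obtain ⟨_, _⟩ := exists_linearOrder_isStrictOrderedRing R
  exact ⟨R, inferInstance, inferInstance, inferInstance, inferInstance,
    ⟨(Subfield.inclusion hR).comp ι.rangeRestrictField⟩⟩

end RealClosure

section Artin

/-- `a` is nonnegative on the real spectrum of `A` when its image under every ring morphism from `A`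
to a real closed field is nonnegative, the scalar counterpart of `PsdOnRealSpec`. -/
def NonnegOnRealSpec {A : Type u} [CommRing A] (a : A) : Prop :=
  ∀ (R : Type u) [Field R] [LinearOrder R] [IsStrictOrderedRing R] [IsRealClosed R] (φ : A →+* R),
    0 ≤ φ a

theorem NonnegOnRealSpec.map {A B : Type u} [CommRing A] [CommRing B] (φ : A →+* B) {a : A}
    (ha : NonnegOnRealSpec a) : NonnegOnRealSpec (φ a) :=
  fun R _ _ _ _ ψ => ha R (ψ.comp φ)

theorem exists_ringHom_isSemireal_mul_self_eq_neg {K : Type u} [Field K] [IsSemireal K] {a : K}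
    (ha : ¬ IsSumSq a) :
    ∃ (L : Type u) (_ : Field L) (_ : IsSemireal L) (ι : K →+* L) (y : L), y * y = -ι a := by
  by_cases hsq : IsSquare (-a)
  · obtain ⟨x, hx⟩ := hsq
    exact ⟨K, inferInstance, inferInstance, RingHom.id K, x, hx.symm⟩
  · have := Fact.mk (irreducible_X_sq_sub_C hsq)
    have hroot := AdjoinRoot.eval₂_root (X ^ 2 - C (-a))
    rw [eval₂_sub, eval₂_X_pow, eval₂_C, sub_eq_zero] at hroot
    exact ⟨AdjoinRoot (X ^ 2 - C (-a)), inferInstance,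
      isSemireal_adjoinRoot_X_sq_sub_C (by rwa [neg_neg]), AdjoinRoot.of _, AdjoinRoot.root _,
      (pow_two _).symm.trans (hroot.trans (map_neg _ a))⟩

theorem NonnegOnRealSpec.isSumSq {K : Type u} [Field K] (h2 : (2 : K) ≠ 0) {a : K}
    (ha : NonnegOnRealSpec a) : IsSumSq a := by
  by_contra hsum
  have : IsSemireal K := isSemireal_iff_not_isSumSq_neg_one.mpr
    fun h => hsum (isSumSq_of_isSumSq_neg_one h2 h a)
  obtain ⟨L, _, _, ι, y, hy⟩ := exists_ringHom_isSemireal_mul_self_eq_neg hsum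
  obtain ⟨R, _, _, _, _, ⟨φ⟩⟩ := exists_ringHom_isRealClosed L
  have hnonneg : 0 ≤ φ (ι a) := ha R (φ.comp ι)
  have hneg : φ y * φ y = -φ (ι a) := by rw [← map_mul, hy, map_neg]
  have hzero : φ (ι a) = 0 := by linarith [mul_self_nonneg (φ y)]
  rw [map_eq_zero, map_eq_zero] at hzero
  exact hsum (hzero ▸ .zero)

theorem exists_isSumSq_mul_mul_self_eq {A K : Type*} [CommRing A] [IsDomain A] [Field K]
    [Algebra A K] [IsFractionRing A K] {s : K} (hs : IsSumSq s) :
    ∃ b t : A, b ≠ 0 ∧ IsSumSq t ∧ s * algebraMap A K (b * b) = algebraMap A K t := by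
  induction hs with
  | zero => exact ⟨1, 0, one_ne_zero, .zero, by rw [zero_mul, map_zero]⟩
  | sq_add x _ ih =>
    obtain ⟨b, t, hb, ht, hbt⟩ := ih
    obtain ⟨u, v, hv, rfl⟩ := IsFractionRing.div_surjective (A := A) x
    have hv0 : v ≠ 0 := nonZeroDivisors.ne_zero hv
    have hv1 : algebraMap A K v ≠ 0 := by rwa [ne_eq, FaithfulSMul.algebraMap_eq_zero_iff]
    refine ⟨b * v, u * b * (u * b) + t * (v * v), mul_ne_zero hb hv0,
      .sq_add _ (ht.mul (.mul_self v)), ?_⟩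
    simp only [map_mul, map_add] at hbt ⊢
    field_simp
    linear_combination algebraMap A K v ^ 2 * hbt

theorem NonnegOnRealSpec.exists_mul_mul_self_isSumSq {A : Type u} [CommRing A] [IsDomain A]
    (h2 : (2 : A) ≠ 0) {a : A} (ha : NonnegOnRealSpec a) : ∃ b, b ≠ 0 ∧ IsSumSq (a * (b * b)) := by
  have h2' : (2 : FractionRing A) ≠ 0 := by
    rwa [← map_ofNat (algebraMap A (FractionRing A)), ne_eq, FaithfulSMul.algebraMap_eq_zero_iff]
  obtain ⟨b, t, hb, ht, hbt⟩ :=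
    exists_isSumSq_mul_mul_self_eq (A := A) ((ha.map (algebraMap A (FractionRing A))).isSumSq h2')
  rw [← map_mul] at hbt
  exact ⟨b, hb, IsFractionRing.injective A (FractionRing A) hbt ▸ ht⟩

end Artin

section Multiplicity

variable {A : Type u} [CommRing A] {q : A}

theorem exists_isSumSq_eq_mul_of_dvd [IsFormallyReal (A ⧸ Ideal.span {q})] {s : A}
    (hs : IsSumSq s) (hqs : q ∣ s) : ∃ t, IsSumSq t ∧ s = q * q * t := by
  induction hs with
  | zero => exact ⟨0, .zero, by rw [mul_zero]⟩
  | @sq_add a s hs ih =>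
    let π := Ideal.Quotient.mk (Ideal.span {q})
    have hπ (x : A) : π x = 0 ↔ q ∣ x :=
      Ideal.Quotient.eq_zero_iff_mem.trans Ideal.mem_span_singleton
    have hsum : π a * π a + π s = 0 := by rwa [← map_mul, ← map_add, hπ]
    have haa : π a * π a = 0 :=
      IsFormallyReal.eq_zero_of_add_right (.mul_self _) (isSumSq_map π hs) hsum
    obtain ⟨c, rfl⟩ : q ∣ a := (hπ a).mp (sq_eq_zero_iff.mp ((pow_two _).trans haa))
    obtain ⟨t, ht, rfl⟩ := ih ((hπ s).mp (by rwa [haa, zero_add] at hsum))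
    exact ⟨c * c + t, .sq_add c ht, by ring⟩

theorem not_dvd_two_of_isFormallyReal_quotient [IsFormallyReal (A ⧸ Ideal.span {q})]
    (hq : ¬ IsUnit q) : ¬ q ∣ 2 := by
  intro h2
  have hsum : (1 : A ⧸ Ideal.span {q}) + 1 = 0 := by
    rwa [one_add_one_eq_two, ← map_ofNat (Ideal.Quotient.mk _), Ideal.Quotient.eq_zero_iff_mem,
      Ideal.mem_span_singleton]
  have hone := IsFormallyReal.eq_zero_of_add_right .one .one hsum
  rw [← map_one (Ideal.Quotient.mk _), Ideal.Quotient.eq_zero_iff_mem,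
    Ideal.mem_span_singleton] at hone
  exact hq (isUnit_of_dvd_one hone)

theorem even_natCast_enat_iff {n : ℕ} : Even (n : ℕ∞) ↔ Even n := by
  refine ⟨fun ⟨k, hk⟩ => ?_, fun h => h.map (Nat.castRingHom ℕ∞)⟩
  lift k to ℕ using by rintro rfl; simp at hk
  exact ⟨k, mod_cast hk⟩

theorem even_emultiplicity_iff {α : Type*} [Monoid α] {q a : α} :
    Even (emultiplicity q a) ↔ ∀ n, Odd n → q ^ n ∣ a → q ^ (n + 1) ∣ a := by
  simp only [pow_dvd_iff_le_emultiplicity]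
  induction emultiplicity q a using ENat.recTopCoe with
  | top => simp [show Even (⊤ : ℕ∞) from ⟨⊤, rfl⟩]
  | coe m =>
    simp only [even_natCast_enat_iff, Nat.cast_le]
    refine ⟨fun hm n hn hnm => by grind, fun h => ?_⟩
    by_contra hm
    exact (h m (Nat.not_even_iff_odd.mp hm) le_rfl).not_gt m.lt_succ_self

theorem even_emultiplicity_of_mul_mul_self {α : Type*} [CommMonoidWithZero α] [IsCancelMulZero α]
    {q a b : α} (hq : Prime q) (hb : FiniteMultiplicity q b)
    (h : Even (emultiplicity q (a * (b * b)))) : Even (emultiplicity q a) := by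
  rw [emultiplicity_mul hq, emultiplicity_mul hq, hb.emultiplicity_eq_multiplicity] at h
  generalize emultiplicity q a = e at h ⊢
  induction e using ENat.recTopCoe with
  | top => exact ⟨⊤, rfl⟩
  | coe n =>
    norm_cast at h
    rw [even_natCast_enat_iff] at h ⊢
    exact (Nat.even_add.mp h).mpr ⟨_, rfl⟩

theorem even_emultiplicity_of_isRelPrime_mul {α : Type*} [CommMonoidWithZero α] [IsCancelMulZero α]
    {x y q : α} (hq : Prime q) (hxy : IsRelPrime x y) (h : Even (emultiplicity q (x * y))) :
    Even (emultiplicity q x) ∧ Even (emultiplicity q y) := by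
  rw [emultiplicity_mul hq] at h
  by_cases hqx : q ∣ x
  · have hqy : ¬ q ∣ y := fun hqy => hq.not_isUnit (hxy hqx hqy)
    rw [emultiplicity_eq_zero.mpr hqy] at h ⊢
    exact ⟨by rwa [add_zero] at h, .zero⟩
  · rw [emultiplicity_eq_zero.mpr hqx] at h ⊢
    exact ⟨.zero, by rwa [zero_add] at h⟩

theorem even_emultiplicity_of_isSumSq [IsDomain A] [IsFormallyReal (A ⧸ Ideal.span {q})]
    (hq : q ≠ 0) {s : A} (hs : IsSumSq s) : Even (emultiplicity q s) := by
  rw [even_emultiplicity_iff]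
  rintro n ⟨k, rfl⟩ hqs
  induction k generalizing s with
  | zero =>
    obtain ⟨t, -, rfl⟩ := exists_isSumSq_eq_mul_of_dvd hs (by simpa using hqs)
    exact ⟨t, by ring⟩
  | succ k ih =>
    obtain ⟨t, ht, rfl⟩ :=
      exists_isSumSq_eq_mul_of_dvd hs ((dvd_pow_self q (Nat.succ_ne_zero _)).trans hqs)
    have hpow (m : ℕ) : q ^ (m + 2) ∣ q * q * t ↔ q ^ m ∣ t := by
      rw [pow_add, mul_comm, pow_two, mul_dvd_mul_iff_left (mul_ne_zero hq hq)]
    exact (hpow (2 * k + 2)).mpr (ih ht ((hpow (2 * k + 1)).mp hqs))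

theorem NonnegOnRealSpec.even_emultiplicity [IsDomain A] [WfDvdMonoid A]
    [IsFormallyReal (A ⧸ Ideal.span {q})] (hq : Prime q) {a : A} (ha : NonnegOnRealSpec a) :
    Even (emultiplicity q a) := by
  have h2 : (2 : A) ≠ 0 := fun h =>
    not_dvd_two_of_isFormallyReal_quotient hq.not_isUnit (h ▸ dvd_zero q)
  obtain ⟨b, hb, hsum⟩ := ha.exists_mul_mul_self_isSumSq h2
  exact even_emultiplicity_of_mul_mul_self hq (.of_prime_left hq hb)
    (even_emultiplicity_of_isSumSq hq.ne_zero hsum)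

theorem even_emultiplicity_of_polarization [IsDomain A] (hq : Prime q) (h2 : ¬ q ∣ 2) {a b d : A}
    (hda : d ∣ a) (hdb : d ∣ b) (ha : Even (emultiplicity q a)) (hb : Even (emultiplicity q b))
    (hab : Even (emultiplicity q (a + b + 2 * d))) : Even (emultiplicity q d) := by
  rw [even_emultiplicity_iff] at ha hb hab ⊢
  intro n hn hnd
  have hna := ha n hn (hnd.trans hda)
  have hnb := hb n hn (hnd.trans hdb)
  have hnab := hab n hn
    (((hnd.trans hda).add (hnd.trans hdb)).add (hnd.mul_left 2))
  exact hq.pow_dvd_of_dvd_mul_left _ h2 ((dvd_add_right (hna.add hnb)).mp hnab)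

theorem IsRealPrime.isFormallyReal_quotient [IsPrincipalIdealRing A]
    (hq : Irreducible q) (hr : IsRealPrime (Ideal.span {q})) :
    IsFormallyReal (A ⧸ Ideal.span {q}) := by
  have := PrincipalIdealRing.isMaximal_of_irreducible hq
  let _ := Ideal.Quotient.field (Ideal.span {q})
  have := hr.2
  exact isFormallyReal_of_isSemireal (A ⧸ Ideal.span {q})

end Multiplicity

section Matrix

open Matrix

theorem dotProduct_mulVec_add_self_of_isSymm {R m : Type*} [CommRing R] [Fintype m]
    {M : Matrix m m R} (hM : M.IsSymm) (v w : m → R) :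
    (v + w) ⬝ᵥ M *ᵥ (v + w) = v ⬝ᵥ M *ᵥ v + w ⬝ᵥ M *ᵥ w + 2 * (v ⬝ᵥ M *ᵥ w) := by
  have hcomm : w ⬝ᵥ M *ᵥ v = v ⬝ᵥ M *ᵥ w := by
    rw [← dotProduct_transpose_mulVec, hM.eq]
  rw [mulVec_add, dotProduct_add, add_dotProduct, add_dotProduct, hcomm]
  ring

theorem exists_dotProduct_mulVec_eq_of_eq_mul_diagonal_mul {R m : Type*} [CommRing R] [Fintype m]
    [DecidableEq m] {M P Q : Matrix m m R} (hP : IsUnit P.det) (hQ : IsUnit Q.det) {D : m → R}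
    (h : M = P * diagonal D * Q) (k : m) :
    ∃ v w, v ⬝ᵥ M *ᵥ w = D k ∧ (∀ y, D k ∣ v ⬝ᵥ M *ᵥ y) ∧ ∀ x, D k ∣ x ⬝ᵥ M *ᵥ w := by
  have hform (x y : m → R) : x ⬝ᵥ M *ᵥ y = (x ᵥ* P) ⬝ᵥ diagonal D *ᵥ (Q *ᵥ y) := by
    rw [h, ← mulVec_mulVec, ← mulVec_mulVec, dotProduct_mulVec]
  obtain ⟨v, hv⟩ : ∃ v, v ᵥ* P = Pi.single k 1 :=
    ⟨Pi.single k 1 ᵥ* P⁻¹, by rw [vecMul_vecMul, nonsing_inv_mul _ hP, vecMul_one]⟩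
  obtain ⟨w, hw⟩ : ∃ w, Q *ᵥ w = Pi.single k 1 :=
    ⟨Q⁻¹ *ᵥ Pi.single k 1, by rw [mulVec_mulVec, mul_nonsing_inv _ hQ, one_mulVec]⟩
  have hleft (y : m → R) : v ⬝ᵥ M *ᵥ y = D k * (Q *ᵥ y) k := by
    rw [hform, hv, single_dotProduct, one_mul, mulVec_diagonal]
  have hright (x : m → R) : x ⬝ᵥ M *ᵥ w = (x ᵥ* P) k * D k := by
    rw [hform, hw, diagonal_mulVec_single, dotProduct_single, mul_one]
  refine ⟨v, w, ?_, fun y => ⟨_, hleft y⟩, fun x => ⟨_, (hright x).trans (mul_comm _ _)⟩⟩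
  rw [hright, hv, Pi.single_eq_same, one_mul]

theorem PsdOnRealSpec.nonnegOnRealSpec_dotProduct_mulVec {A : Type u} [CommRing A] {n : ℕ}
    {M : Matrix (Fin n) (Fin n) A} (hpsd : PsdOnRealSpec M) (x : Fin n → A) :
    NonnegOnRealSpec (x ⬝ᵥ M *ᵥ x) := by
  intro R _ _ _ _ φ
  have hmap : φ ∘ (M *ᵥ x) = M.map φ *ᵥ (φ ∘ x) := funext (RingHom.map_mulVec φ M x)
  rw [RingHom.map_dotProduct, hmap]
  exact hpsd R φ (φ ∘ x)

theorem PsdOnRealSpec.even_emultiplicity_of_matrixEquivalent_diagonal {A : Type u} [CommRing A]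
    [IsDomain A] [WfDvdMonoid A] {n : ℕ} {M : Matrix (Fin n) (Fin n) A} (hpsd : PsdOnRealSpec M)
    (hM : M.IsSymm) {D : Fin n → A} (hMD : MatrixEquivalent M (diagonal D)) {q : A} (hq : Prime q)
    [IsFormallyReal (A ⧸ Ideal.span {q})] (k : Fin n) : Even (emultiplicity q (D k)) := by
  obtain ⟨P, Q, hP, hQ, h⟩ := hMD
  obtain ⟨v, w, hvw, hv, hw⟩ := exists_dotProduct_mulVec_eq_of_eq_mul_diagonal_mul hP hQ h k
  have heven (x : Fin n → A) : Even (emultiplicity q (x ⬝ᵥ M *ᵥ x)) :=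
    (hpsd.nonnegOnRealSpec_dotProduct_mulVec x).even_emultiplicity hq
  refine even_emultiplicity_of_polarization hq
    (not_dvd_two_of_isFormallyReal_quotient hq.not_isUnit) (hv v) (hw w) (heven v) (heven w) ?_
  rw [← hvw, ← dotProduct_mulVec_add_self_of_isSymm hM]
  exact heven (v + w)

end Matrix

section Positivity

variable {A : Type u} [CommRing A] {α : RealSpec A} {a b : A}

theorem RealSpec.Nonneg.mul (ha : α.Nonneg a) (hb : α.Nonneg b) : α.Nonneg (a * b) := by
  let _ := α.order
  have := α.isStrictOrderedRing
  unfold RealSpec.Nonneg at *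
  rw [map_mul]
  exact mul_nonneg ha hb

theorem RealSpec.nonneg_mul_self (α : RealSpec A) (a : A) : α.Nonneg (a * a) := by
  let _ := α.order
  have := α.isStrictOrderedRing
  unfold RealSpec.Nonneg
  rw [map_mul]
  exact mul_self_nonneg _

theorem RealSpec.nonneg_one (α : RealSpec A) : α.Nonneg 1 :=
  one_mul (1 : A) ▸ α.nonneg_mul_self 1

theorem RealSpec.Nonneg.pow (ha : α.Nonneg a) (n : ℕ) : α.Nonneg (a ^ n) := by
  induction n with
  | zero => exact pow_zero a ▸ α.nonneg_one
  | succ n ih => exact pow_succ a n ▸ ih.mul ha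

theorem RealSpec.Pos.nonneg (ha : α.Pos a) : α.Nonneg a :=
  @le_of_lt _ α.order.toPreorder _ _ ha

theorem PNRI.exists_associated_pow_nonneg [IsDomain A] (hA : PNRI A) {p : A} (hp : Prime p) {i : ℕ}
    (hi : IsRealPrime (Ideal.span {p}) → Even i) :
    ∃ d, Associated (p ^ i) d ∧ ∀ α : RealSpec A, α.Nonneg d := by
  by_cases hreal : IsRealPrime (Ideal.span {p})
  · obtain ⟨j, rfl⟩ := hi hreal
    exact ⟨p ^ j * p ^ j, .of_eq (pow_add p j j), fun α => α.nonneg_mul_self _⟩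
  · obtain ⟨p', hpp', -, hpos⟩ := hA p ⟨hp.irreducible, hreal⟩
    exact ⟨p' ^ i, hpp'.pow_pow, fun α => (hpos α).nonneg.pow i⟩

theorem PNRI.exists_associated_nonneg [IsDomain A] [UniqueFactorizationMonoid A] (hA : PNRI A)
    {d : A} (hd : ∀ q, Irreducible q → IsRealPrime (Ideal.span {q}) → Even (emultiplicity q d)) :
    ∃ d', Associated d d' ∧ ∀ α : RealSpec A, α.Nonneg d' := by
  induction d using UniqueFactorizationMonoid.induction_on_coprime with
  | h0 => exact ⟨0, .rfl, fun α => mul_zero (0 : A) ▸ α.nonneg_mul_self 0⟩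
  | h1 hu => exact ⟨1, associated_one_iff_isUnit.mpr hu, RealSpec.nonneg_one⟩
  | @hpr p i hp =>
    refine hA.exists_associated_pow_nonneg hp fun hreal => ?_
    have := hd p hp.irreducible hreal
    rwa [emultiplicity_pow_self_of_prime hp, even_natCast_enat_iff] at this
  | @hcp x y hxy hx hy =>
    have heven q (hq : Irreducible q) (hr : IsRealPrime (Ideal.span {q})) :=
      even_emultiplicity_of_isRelPrime_mul hq.prime hxy (hd q hq hr)
    obtain ⟨x', hxx', hx'⟩ := hx fun q hq hr => (heven q hq hr).1
    obtain ⟨y', hyy', hy'⟩ := hy fun q hq hr => (heven q hq hr).2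
    exact ⟨x' * y', hxx'.mul_mul hyy', fun α => (hx' α).mul (hy' α)⟩

end Positivity

theorem mainTheorem2_general {A : Type u} [CommRing A] [IsDomain A] [IsPrincipalIdealRing A]
    (hA : PNRI A) {n : ℕ} {M : Matrix (Fin n) (Fin n) A} (hM : M.IsSymm) (hpsd : PsdOnRealSpec M)
    {D : Fin n → A} (hMD : MatrixEquivalent M (Matrix.diagonal D)) (k : Fin n) :
    ∃ d' : A, Associated (D k) d' ∧ ∀ α : RealSpec A, α.Nonneg d' := by
  refine hA.exists_associated_nonneg fun q hq hreal => ?_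
  have := hreal.isFormallyReal_quotient hq
  exact hpsd.even_emultiplicity_of_matrixEquivalent_diagonal hM hMD hq.prime k

theorem mainTheorem2 {A : Type u} [CommRing A] [IsDomain A] [IsPrincipalIdealRing A]
    (hA : PNRI A) {n r : ℕ} (M : Matrix (Fin n) (Fin n) A) (hM : M.IsSymm)
    (hpsd : PsdOnRealSpec M) (d : Fin r → A) (hd : IsSmithNormalForm M d) (k : Fin r) :
    ∃ d' : A, Associated (d k) d' ∧ ∀ α : RealSpec A, α.Nonneg d' := by
  simpa using mainTheorem2_general hA hM hpsd hd.equiv (Fin.castLE hd.le k)
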